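/- **Theorem (Finite gap).** Let $G$ be a finite group of order $D$, let $\mathcal H_A,\mathcal H_B$ be $D$-dimensional complex Hilbert spaces with orthonormal bases $\{|g\rangle^A\}_{g\in G}$, $\{|g\rangle^B\}_{g\in G}$, and let $\mathcal H_a,\mathcal H_b$ be further copies of $\mathcal H_A,\mathcal H_B$. Let $\lambda_g\ge 0$ with $\sum_{g\in G}\lambda_g=1$, let $\vartheta_{f,g}\in\mathbb R$ be arbitrary phases, and consider the set $\mathcal S=\{|\psi_f\rangle\}_{f\in G}$ of $D$ group-shifted states $$|\psi_f\rangle^{AB}=\sum_{g\in G}\sqrt{\lambda_g}\,e^{i\vartheta_{f,g}}\,|g\rangle^A|fg\rangle^B ,\qquad f\in G .$$ Assume that the states $|\psi_f\rangle$ have full Schmidt rank (all $D$ Schmidt coefficients are nonzero) and are not maximally entangled (their Schmidt coefficients are not all equal to $1/D$). Let $|\phi\rangle^{ab}\in\mathcal H_a\otimes\mathcal H_b$ be a unit vector (the blank state), and suppose that $\mathcal S$ can be locally cloned with $|\phi\rangle$ by a separable operation, that is, there are finitely many operators $A_m$ on $\mathcal H_A\otimes\mathcal H_a$ and $B_m$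 on $\mathcal H_B\otimes\mathcal H_b$ with $\sum_m A_m^\dagger A_m\otimes B_m^\dagger B_m=I$ such that, for all $f\in G$, $$\sum_m (A_m\otimes B_m)\bigl(|\psi_f\rangle\langle\psi_f|^{AB}\otimes|\phi\rangle\langle\phi|^{ab}\bigr)(A_m\otimes B_m)^\dagger=|\psi_f\rangle\langle\psi_f|^{AB}\otimes|\psi_f\rangle\langle\psi_f|^{ab}.$$ Put $q_r=\sum_{f\in G}\lambda_f\lambda_{fr}$ for $r\in G$. Then $\sum_{r\in G}q_r=1$ and $$E(\phi)\;\ge\; H(\{q_r\})\;>\;E(\psi_f)\qquad\text{for all } f\in G .$$ Here $H(\{q_r\})=-\sum_{r}q_r\log_D q_r$ is the Shannon entropy and $E(\chi)=-\sum_{r}\mu_r\log_D\mu_r$ is the entropy of entanglement of a state $\chi$ with Schmidt coefficients $\mu_0,\dots,\mu_{D-1}$ (the squares of the coefficients of its Schmidt decomposition), with $0\log_D 0=0$. In particular the blank state must be strictly more entangled than the states being cloned. -/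

import Mathlib

open scoped TensorProduct InnerProductSpace
open Module

noncomputable section QuantumStates

variable {HA : Type*} [NormedAddCommGroup HA] [InnerProductSpace ℂ HA] [FiniteDimensional ℂ HA]
variable {HB : Type*} [NormedAddCommGroup HB] [InnerProductSpace ℂ HB] [FiniteDimensional ℂ HB]

/-- Map-state duality with respect to an orthonormal basis `b` of the second factor: the ket
`∑ c i j • |i⟩ ⊗ |b j⟩` becomes the operator `∑ c i j • |i⟩⟨b j|`. -/
def stateMap {ι : Type*} [Fintype ι] (b : OrthonormalBasis ι ℂ HB) (χ : HA ⊗[ℂ] HB) :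
    HB →ₗ[ℂ] HA :=
  ∑ j, (innerₛₗ ℂ (b j)).smulRight
    (TensorProduct.rid ℂ HA (TensorProduct.map LinearMap.id (innerₛₗ ℂ (b j)) χ))

/-- The Schmidt coefficients of a bipartite vector in decreasing order: the squares of the singular
values of the operator that corresponds to it under map-state duality. (They do not depend on the
basis used for the duality.) The spaces are meant to have the same dimension `D`, and the
coefficients are then numbered `0, …, D - 1`. -/
def schmidtCoeff (χ : HA ⊗[ℂ] HB) (r : Fin (finrank ℂ HA)) : ℝ :=
  (stateMap (stdOrthonormalBasis ℂ HB) χ).singularValues r ^ 2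

/-- The Schmidt rank: the number of nonzero Schmidt coefficients. -/
def schmidtRank (χ : HA ⊗[ℂ] HB) : ℕ :=
  Nat.card {r : Fin (finrank ℂ HA) // schmidtCoeff χ r ≠ 0}

/-- Full Schmidt rank: the Schmidt rank equals the local dimension. -/
def FullSchmidtRank (χ : HA ⊗[ℂ] HB) : Prop :=
  schmidtRank χ = finrank ℂ HA

/-- Maximally entangled: all `D` Schmidt coefficients are equal to `1 / D`. -/
def MaximallyEntangled (χ : HA ⊗[ℂ] HB) : Prop :=
  ∀ r, schmidtCoeff χ r = 1 / (finrank ℂ HA : ℝ)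

/-- The Shannon entropy `- ∑ p r * log_D (p r)`, with logarithms to base `D`. -/
def shannonEntropy {ι : Type*} [Fintype ι] (D : ℕ) (p : ι → ℝ) : ℝ :=
  - ∑ r, p r * Real.logb D (p r)

/-- The entropy of entanglement of a vector of a `D × D` system, with logarithms to base `D`. -/
def entanglementEntropy (χ : HA ⊗[ℂ] HB) : ℝ :=
  shannonEntropy (finrank ℂ HA) (schmidtCoeff χ)

/-- The group-shifted states `|ψ_f⟩ = ∑ g, √(lam g) e^{i (θ f g)} |g⟩ ⊗ |f g⟩`. -/
def groupShifted {G : Type*} [Group G] [Fintype G]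
    (eA : OrthonormalBasis G ℂ HA) (eB : OrthonormalBasis G ℂ HB)
    (lam : G → ℝ) (θ : G → G → ℝ) (f : G) : HA ⊗[ℂ] HB :=
  ∑ g, ((Real.sqrt (lam g) : ℂ) * Complex.exp (Complex.I * (θ f g : ℂ))) •
    (eA g ⊗ₜ[ℂ] eB (f * g))

/-- The operator `|x⟩⟨x|`. -/
def ketbra {K : Type*} [NormedAddCommGroup K] [InnerProductSpace ℂ K] (x : K) : K →ₗ[ℂ] K :=
  (InnerProductSpace.rankOne ℂ x x).toLinearMap

/-- A separable operation on a bipartite system: it has finitely many product Kraus operators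
`A m ⊗ B m`, and these satisfy the closure condition `∑ A m† A m ⊗ B m† B m = 1`. -/
def IsSeparableOperation (Λ : (HA ⊗[ℂ] HB →ₗ[ℂ] HA ⊗[ℂ] HB) →ₗ[ℂ] (HA ⊗[ℂ] HB →ₗ[ℂ] HA ⊗[ℂ] HB)) :
    Prop :=
  ∃ (M : ℕ) (A : Fin M → (HA →ₗ[ℂ] HA)) (B : Fin M → (HB →ₗ[ℂ] HB)),
    ∑ m, TensorProduct.map ((A m).adjoint ∘ₗ A m) ((B m).adjoint ∘ₗ B m) = LinearMap.id ∧
    ∀ ρ, Λ ρ = ∑ m, TensorProduct.map (A m) (B m) ∘ₗ ρ ∘ₗ (TensorProduct.map (A m) (B m)).adjoint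

/-- For vectors `χ` of the system `AB` and `η` of a second copy `ab` of it, the vector `χ ⊗ η`
regarded as a vector of the bipartite system with parts `Aa` and `Bb`. -/
def jointState (χ η : HA ⊗[ℂ] HB) : (HA ⊗[ℂ] HA) ⊗[ℂ] (HB ⊗[ℂ] HB) :=
  TensorProduct.tensorTensorTensorComm ℂ HA HB HA HB (χ ⊗ₜ[ℂ] η)

/-- The set `S` of states of `AB` can be locally cloned with the blank state `φ` of `ab` by a
separable operation (with respect to the cut `Aa / Bb`): one such operation maps
`|ψ⟩⟨ψ| ⊗ |φ⟩⟨φ|` to `|ψ⟩⟨ψ| ⊗ |ψ⟩⟨ψ|` for all `ψ` in `S`. -/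
def LocallyClonable (S : Set (HA ⊗[ℂ] HB)) (φ : HA ⊗[ℂ] HB) : Prop :=
  ∃ Λ : ((HA ⊗[ℂ] HA) ⊗[ℂ] (HB ⊗[ℂ] HB) →ₗ[ℂ] (HA ⊗[ℂ] HA) ⊗[ℂ] (HB ⊗[ℂ] HB)) →ₗ[ℂ]
      ((HA ⊗[ℂ] HA) ⊗[ℂ] (HB ⊗[ℂ] HB) →ₗ[ℂ] (HA ⊗[ℂ] HA) ⊗[ℂ] (HB ⊗[ℂ] HB)),
    IsSeparableOperation Λ ∧
      ∀ ψ ∈ S, Λ (ketbra (jointState ψ φ)) = ketbra (jointState ψ ψ)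

end QuantumStates

/-! Bipartite vectors are treated as `D × D` matrices. A Kraus operator of the cloning map must send
a pure input to a multiple of the pure output, so `A_m (Ψ_f ⊗ Φ) B_m = c_{m,f} Ψ_f ⊗ Ψ_f`. Since
`|det Ψ_f|` is nonzero and the same for all `f`, `|c_{m,f}|` depends on `m` only (`norm_factor_eq`).

Cut the Schmidt decomposition of the blank state after `k` terms: `Φ = U V + Φ₂`. The kernel of `(1
⊗ V) B_m` has dimension at least `D (D - k)` and is the same for all `f`; on it `Φ₂` alone produces
the output. Summed over `f`, the squared norm of `(Ψ_f ⊗ Ψ_f) v` is a diagonal quadratic form in `v`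
in which each `q_r` occurs `D` times, so the kernel collects at least `D |c_m|²` times the sum of
the `D - k` smallest `q_r`. The closure condition preserves total Frobenius norm, and summing over
`m` bounds this tail of `q` by `‖Φ₂‖²`, the tail of the Schmidt coefficients of `φ`
(`autocorrelation_tail_le`).

Hence `q` majorizes those coefficients, and Schur concavity gives `E(φ) ≥ H(q)`. The strict
inequality is Jensen's: `q` is the `λ`-mixture of translates of `λ`, and `λ` is not constant
(`sum_negMulLog_lt_autocorrelation`). -/

set_option linter.unusedSectionVars false

/-! ### Schmidt decomposition and Schmidt coefficients. -/

section Schmidt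

variable {HA : Type*} [NormedAddCommGroup HA] [InnerProductSpace ℂ HA] [FiniteDimensional ℂ HA]
variable {HB : Type*} [NormedAddCommGroup HB] [InnerProductSpace ℂ HB] [FiniteDimensional ℂ HB]
variable {ι κ : Type*} [Fintype ι] [Fintype κ]

theorem stateMap_apply_basis (b : OrthonormalBasis ι ℂ HB) (χ : HA ⊗[ℂ] HB) (j : ι) :
    stateMap b χ (b j) =
      TensorProduct.rid ℂ HA (TensorProduct.map LinearMap.id (innerₛₗ ℂ (b j)) χ) := by
  classical
  simp only [stateMap, LinearMap.sum_apply, LinearMap.smulRight_apply, innerₛₗ_apply_apply,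
    b.inner_eq_ite, ite_smul, one_smul, zero_smul]
  simp

theorem sum_stateMap_tmul (b : OrthonormalBasis ι ℂ HB) (χ : HA ⊗[ℂ] HB) :
    ∑ j, stateMap b χ (b j) ⊗ₜ[ℂ] b j = χ := by
  simp only [stateMap_apply_basis]
  induction χ with
  | zero => simp
  | tmul x y =>
    simp only [TensorProduct.map_tmul, LinearMap.id_apply, TensorProduct.rid_tmul,
      innerₛₗ_apply_apply, TensorProduct.smul_tmul]
    rw [← TensorProduct.tmul_sum, b.sum_repr']
  | add x y hx hy =>
    simp only [map_add, TensorProduct.add_tmul, Finset.sum_add_distrib, hx, hy]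

/-- The entrywise conjugate, with respect to the basis `b`, of the vector `u`. -/
noncomputable def conjVector (b : OrthonormalBasis ι ℂ HB) (u : HB) : HB :=
  ∑ j, inner ℂ u (b j) • b j

theorem inner_conjVector (b : OrthonormalBasis ι ℂ HB) (u v : HB) :
    inner ℂ (conjVector b u) (conjVector b v) = inner ℂ v u := by
  simp only [conjVector]
  rw [b.orthonormal.inner_sum, ← b.sum_inner_mul_inner]
  refine Finset.sum_congr rfl fun j _ => ?_
  rw [inner_conj_symm, mul_comm]

theorem orthonormal_conjVector (b : OrthonormalBasis ι ℂ HB) {u : κ → HB}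
    (hu : Orthonormal ℂ u) : Orthonormal ℂ fun r => conjVector b (u r) := by
  classical
  rw [orthonormal_iff_ite] at hu ⊢
  intro i j
  rw [inner_conjVector, hu]
  simp [eq_comm]

/-- The numbers `⟨u r, b j⟩` that expand `b j` in `u` are also the coordinates of the conjugated `u
r`, so a change of basis passes from one tensor factor to the other. -/
theorem sum_stateMap_tmul_conjVector (b : OrthonormalBasis ι ℂ HB) (u : OrthonormalBasis κ ℂ HB)
    (χ : HA ⊗[ℂ] HB) :
    ∑ r, stateMap b χ (u r) ⊗ₜ[ℂ] conjVector b (u r) = χ := by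
  conv_rhs => rw [← sum_stateMap_tmul b χ]
  simp only [conjVector, TensorProduct.tmul_sum, TensorProduct.tmul_smul]
  rw [Finset.sum_comm]
  refine Finset.sum_congr rfl fun j _ => ?_
  have h : stateMap b χ (b j) = ∑ r, inner ℂ (u r) (b j) • stateMap b χ (u r) := by
    conv_lhs => rw [← u.sum_repr' (b j)]
    simp
  rw [h, TensorProduct.sum_tmul]
  simp [TensorProduct.smul_tmul']

theorem stateMap_conjVector (b : OrthonormalBasis ι ℂ HB) (χ : HA ⊗[ℂ] HB) (v : HB) :
    stateMap b χ (conjVector b v) =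
      TensorProduct.rid ℂ HA (TensorProduct.map LinearMap.id (innerₛₗ ℂ v) χ) := by
  have h : stateMap b χ (conjVector b v) = ∑ j, inner ℂ v (b j) • stateMap b χ (b j) := by
    simp [conjVector]
  rw [h]
  conv_rhs => rw [← sum_stateMap_tmul b χ]
  simp

/-- Schmidt decomposition, with the Schmidt coefficients in decreasing order. -/
theorem exists_schmidt_decomposition (hdim : finrank ℂ HB = finrank ℂ HA) (χ : HA ⊗[ℂ] HB) :
    ∃ (x : Fin (finrank ℂ HA) → HA) (y : Fin (finrank ℂ HA) → HB),
      Orthonormal ℂ y ∧ χ = ∑ r, x r ⊗ₜ[ℂ] y r ∧ ∀ r, ‖x r‖ ^ 2 = schmidtCoeff χ r := by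
  set b := stdOrthonormalBasis ℂ HB
  set T := stateMap b χ
  have hT := T.isSymmetric_adjoint_comp_self
  set u := hT.eigenvectorBasis hdim
  refine ⟨fun r => T (u r), fun r => conjVector b (u r), orthonormal_conjVector b u.orthonormal,
    (sum_stateMap_tmul_conjVector b u χ).symm, fun r => ?_⟩
  have h1 : schmidtCoeff χ r = hT.eigenvalues hdim r := T.sq_singularValues_fin hdim r
  have h2 : inner ℂ (T (u r)) (T (u r)) = (hT.eigenvalues hdim r : ℂ) := by
    rw [← LinearMap.adjoint_inner_right]
    have := hT.apply_eigenvectorBasis hdim r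
    rw [LinearMap.comp_apply] at this
    rw [this, inner_smul_right]
    change _ * inner ℂ (u r) (u r) = _
    simp
  rw [h1]
  have h3 := congrArg Complex.re h2
  rwa [Complex.ofReal_re, ← RCLike.re_to_complex, inner_self_eq_norm_sq] at h3

theorem norm_sq_sum_tmul_of_orthonormal (x : κ → HA) {y : κ → HB} (hy : Orthonormal ℂ y)
    (s : Finset κ) : ‖∑ r ∈ s, x r ⊗ₜ[ℂ] y r‖ ^ 2 = ∑ r ∈ s, ‖x r‖ ^ 2 := by
  classical
  have h : inner ℂ (∑ r ∈ s, x r ⊗ₜ[ℂ] y r) (∑ r ∈ s, x r ⊗ₜ[ℂ] y r) =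
      ∑ r ∈ s, inner ℂ (x r) (x r) := by
    simp only [sum_inner, inner_sum, TensorProduct.inner_tmul, orthonormal_iff_ite.mp hy]
    simp
  have h2 := congrArg RCLike.re h
  rw [map_sum] at h2
  rw [norm_sq_eq_re_inner (𝕜 := ℂ), h2]
  exact Finset.sum_congr rfl fun r _ => inner_self_eq_norm_sq _

/-- The Schmidt coefficients can be read off from any Schmidt decomposition. -/
theorem map_schmidtCoeff_eq (eA : OrthonormalBasis κ ℂ HA) (e : OrthonormalBasis κ ℂ HB)
    (s : κ → ℂ) (χ : HA ⊗[ℂ] HB) (hχ : χ = ∑ g, s g • (eA g ⊗ₜ[ℂ] e g)) :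
    (Finset.univ : Finset (Fin (finrank ℂ HA))).val.map (schmidtCoeff χ) =
      (Finset.univ : Finset κ).val.map fun g => ‖s g‖ ^ 2 := by
  classical
  have hdim : finrank ℂ HB = finrank ℂ HA := by
    rw [finrank_eq_card_basis eA.toBasis, finrank_eq_card_basis e.toBasis]
  set b := stdOrthonormalBasis ℂ HB
  set T := stateMap b χ with hTdef
  have hT := T.isSymmetric_adjoint_comp_self
  have hv := orthonormal_conjVector b e.orthonormal
  have hspan : ⊤ ≤ Submodule.span ℂ (Set.range fun r => conjVector b (e r)) := by
    refine (LinearIndependent.span_eq_top_of_card_eq_finrank' hv.linearIndependent ?_).ge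
    rw [finrank_eq_card_basis e.toBasis]
  let v : OrthonormalBasis κ ℂ HB := OrthonormalBasis.mk hv hspan
  have hTv : ∀ g, T (v g) = s g • eA g := by
    intro g
    have : v g = conjVector b (e g) := by simp [v]
    rw [this, hTdef, stateMap_conjVector, hχ]
    simp [e.inner_eq_ite]
  -- The conjugates of the `e g` diagonalize `T† T`. Comparing the roots of its characteristic
  -- polynomial as multisets avoids sorting the index set `κ`.
  have hmat : LinearMap.toMatrix v.toBasis v.toBasis (T.adjoint ∘ₗ T) =
      Matrix.diagonal fun g => ((‖s g‖ ^ 2 : ℝ) : ℂ) := by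
    ext i j
    rw [LinearMap.toMatrix_apply]
    simp only [OrthonormalBasis.coe_toBasis, OrthonormalBasis.coe_toBasis_repr_apply,
      v.repr_apply_apply, LinearMap.comp_apply, LinearMap.adjoint_inner_right, hTv,
      inner_smul_left, inner_smul_right, eA.inner_eq_ite, Matrix.diagonal_apply]
    split_ifs with h
    · subst h
      rw [mul_one, mul_comm, RCLike.conj_mul]
      norm_cast
    · simp
  have hroots := hT.roots_charpoly_eq_eigenvalues hdim
  rw [← LinearMap.charpoly_toMatrix _ v.toBasis, hmat, Matrix.charpoly_diagonal,
    Polynomial.roots_prod _ _ 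
      (Finset.prod_ne_zero_iff.2 fun _ _ => Polynomial.X_sub_C_ne_zero _)] at hroots
  have h2 := congrArg (Multiset.map RCLike.re) hroots.symm
  simp only [Polynomial.roots_X_sub_C, Multiset.bind_singleton, Multiset.map_map,
    Function.comp_def] at h2
  have h1 : schmidtCoeff χ = hT.eigenvalues hdim :=
    funext fun r => T.sq_singularValues_fin hdim r
  rw [h1]
  simpa only [Complex.coe_algebraMap, RCLike.re_to_complex, Complex.ofReal_re,
    RCLike.ofReal_re] using h2

end Schmidt

/-! ### Majorization and entropy inequalities. -/

section Entropy

/-- The sum of the `j` last terms of an antitone sequence is dominated by any weighted sum with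
weights at most `c` and total weight at least `c * j`. -/
theorem sum_tail_le_weighted_sum {n : ℕ} {p : Fin n → ℝ} (hp : Antitone p) (hp0 : ∀ i, 0 ≤ p i)
    {c : ℝ} {s : Fin n → ℝ} (hs0 : ∀ i, 0 ≤ s i) (hsc : ∀ i, s i ≤ c) (k : ℕ) (hk : k ≤ n)
    (hs : c * (n - k : ℝ) ≤ ∑ i, s i) :
    c * ∑ i with k ≤ i.val, p i ≤ ∑ i, s i * p i := by
  rcases hk.eq_or_lt with rfl | hk
  · have : (Finset.univ.filter fun i : Fin k => k ≤ i.val) = ∅ := by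
      ext i; simp
    rw [this]
    simpa using Finset.sum_nonneg fun i _ => mul_nonneg (hs0 i) (hp0 i)
  -- The threshold value: to its left `p ≥ t` and `s` exceeds the extremal weight `0`; from `k` on
  -- `p ≤ t` and `s` is at most `c`.
  set t := p ⟨k, hk⟩
  have hcard : ∑ i : Fin n, (if k ≤ i.val then c else 0) = c * (n - k : ℝ) := by
    rw [← Finset.sum_filter, Finset.sum_const, nsmul_eq_mul, mul_comm]
    congr 1
    have : (Finset.univ.filter fun i : Fin n => k ≤ i.val) = Finset.Ici ⟨k, hk⟩ := by
      ext i; simp [Fin.le_def]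
    rw [this, Fin.card_Ici, Nat.cast_sub hk.le]
  have key : ∀ i, ((if k ≤ i.val then c else 0) - s i) * (p i - t) ≤ 0 := by
    intro i
    split_ifs with h
    · exact mul_nonpos_of_nonneg_of_nonpos (sub_nonneg.2 (hsc i))
        (sub_nonpos.2 (hp (Fin.le_def.2 h)))
    · refine mul_nonpos_of_nonpos_of_nonneg (by simpa using hs0 i) (sub_nonneg.2 (hp ?_))
      exact Fin.le_def.2 (not_le.1 h).le
  have h1 := Finset.sum_nonpos fun i (_ : i ∈ Finset.univ) => key i
  simp only [sub_mul, mul_sub, Finset.sum_sub_distrib, ← Finset.sum_mul, hcard] at h1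
  have h2 : ∑ i : Fin n, (if k ≤ i.val then c else 0) * p i = c * ∑ i with k ≤ i.val, p i := by
    rw [Finset.mul_sum, Finset.sum_filter]
    exact Finset.sum_congr rfl fun i _ => by split_ifs <;> simp
  have h3 : 0 ≤ t := hp0 _
  nlinarith

/-- Abel summation: a monotone weight gives a larger sum for the sequence with larger tails. -/
theorem sum_mul_le_sum_mul_of_tail_le {n : ℕ} {w d : Fin n → ℝ} (hw : Monotone w)
    (hd : ∀ k : ℕ, k ≤ n → ∑ i with k ≤ i.val, d i ≤ 0) (hd0 : ∑ i, d i = 0) :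
    ∑ i, w i * d i ≤ 0 := by
  induction n with
  | zero => simp
  | succ n ih =>
    have htail : ∀ k : ℕ, ∑ i with k + 1 ≤ i.val, d i = ∑ i with k ≤ i.val, d (Fin.succ i) := by
      intro k
      rw [Finset.sum_filter, Finset.sum_filter, Fin.sum_univ_succ]
      simp
    rcases n with _ | n
    · have : d 0 = 0 := by simpa using hd0
      simp [this]
    -- The induction merges `d 0` into the next entry. The tail from `1` shows `0 ≤ d 0`, so
    -- replacing `w 0` by `w 1` can only increase the sum.
    let d' : Fin (n + 1) → ℝ := fun i => d i.succ + if i = 0 then d 0 else 0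
    have hd' : ∑ i, d' i = ∑ i, d i := by
      simp only [d', Finset.sum_add_distrib, Finset.sum_ite_eq', Finset.mem_univ, if_true]
      rw [Fin.sum_univ_succ d, add_comm]
    have hstep := ih (w := fun i => w i.succ) (d := d')
      (fun i j h => hw (Fin.succ_le_succ_iff.2 h)) ?_ (hd'.trans hd0)
    · have hd0' : 0 ≤ d 0 := by
        have h1 := hd 1 (by omega)
        rw [htail 0] at h1
        rw [Fin.sum_univ_succ] at hd0
        simp only [Nat.zero_le, Finset.filter_true] at h1
        linarith
      have hexp : ∑ i, w i.succ * d' i = ∑ i : Fin (n + 1), w i.succ * d i.succ + w 1 * d 0 := by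
        simp [d', mul_add, Finset.sum_add_distrib]
      rw [Fin.sum_univ_succ]
      have : w 0 * d 0 ≤ w 1 * d 0 := mul_le_mul_of_nonneg_right (hw (Fin.zero_le _)) hd0'
      linarith
    · intro k hk
      rcases k with _ | k
      · simpa using (hd'.trans hd0).le
      · have h1 := hd (k + 2) (by omega)
        rw [htail] at h1
        refine le_of_eq_of_le (Finset.sum_congr rfl fun i hi => ?_) h1
        have : i ≠ 0 := by
          rintro rfl
          simp at hi
        simp [d', this]

/-- Gibbs' inequality. -/
theorem sum_negMulLog_le_neg_sum_mul_log {ι : Type*} [Fintype ι] {p m : ι → ℝ}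
    (hp : ∀ i, 0 < p i) (hm : ∀ i, 0 < m i) (hsum : ∑ i, m i ≤ ∑ i, p i) :
    ∑ i, Real.negMulLog (p i) ≤ -∑ i, p i * Real.log (m i) := by
  have h : ∀ i, Real.negMulLog (p i) + p i * Real.log (m i) ≤ m i - p i := by
    intro i
    have h1 := Real.log_le_sub_one_of_pos (div_pos (hm i) (hp i))
    rw [Real.log_div (hm i).ne' (hp i).ne'] at h1
    have h2 := mul_le_mul_of_nonneg_left h1 (hp i).le
    have h3 : p i * (m i / p i - 1) = m i - p i := by
      have := (hp i).ne'
      field_simp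
    rw [Real.negMulLog]
    linarith
  have := Finset.sum_le_sum fun i (_ : i ∈ Finset.univ) => h i
  simp only [Finset.sum_add_distrib, Finset.sum_sub_distrib] at this
  linarith

/-- Schur concavity of the Shannon entropy, for a majorizing sequence with positive terms. -/
theorem sum_negMulLog_le_of_tail_le {n : ℕ} {p m : Fin n → ℝ} (hm : Antitone m)
    (hp : ∀ i, 0 < p i) (hsum : ∑ i, p i = ∑ i, m i)
    (htail : ∀ k : ℕ, k ≤ n → ∑ i with k ≤ i.val, p i ≤ ∑ i with k ≤ i.val, m i) :
    ∑ i, Real.negMulLog (p i) ≤ ∑ i, Real.negMulLog (m i) := by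
  rcases n with _ | n
  · simp
  -- The tail condition at the last index makes all of `m` positive, as Gibbs' inequality and the
  -- monotonicity of `log` require.
  have hlast : 0 < m (Fin.last n) := by
    have h := htail n (by omega)
    have h2 : (Finset.univ.filter fun i : Fin (n + 1) => n ≤ i.val) = {Fin.last n} := by
      ext i
      simp only [Finset.mem_filter, Finset.mem_univ, true_and, Finset.mem_singleton, Fin.ext_iff,
        Fin.val_last]
      omega
    rw [h2, Finset.sum_singleton, Finset.sum_singleton] at h
    exact (hp _).trans_le h
  have hmpos : ∀ i, 0 < m i := fun i => hlast.trans_le (hm (Fin.le_last i))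
  have h1 := sum_negMulLog_le_neg_sum_mul_log hp hmpos hsum.ge
  have h2 := sum_mul_le_sum_mul_of_tail_le (w := fun i => -Real.log (m i))
    (d := fun i => p i - m i)
    (fun i j h => neg_le_neg (Real.log_le_log (hmpos j) (hm h)))
    (fun k hk => by
      rw [Finset.sum_sub_distrib]
      exact sub_nonpos.2 (htail k hk))
    (by rw [Finset.sum_sub_distrib, hsum, sub_self])
  simp only [mul_sub, Finset.sum_sub_distrib, neg_mul, Finset.sum_neg_distrib] at h2
  have h3 : ∑ i, Real.negMulLog (m i) = -∑ i, Real.log (m i) * m i := by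
    simp [Real.negMulLog, mul_comm]
  have h4 : ∑ i, p i * Real.log (m i) = ∑ i, Real.log (m i) * p i :=
    Finset.sum_congr rfl fun i _ => mul_comm _ _
  linarith

theorem shannonEntropy_eq_sum_negMulLog {ι : Type*} [Fintype ι] (D : ℕ) (p : ι → ℝ) :
    shannonEntropy D p = (∑ r, Real.negMulLog (p r)) / Real.log D := by
  simp only [shannonEntropy, Real.logb, Real.negMulLog, Finset.sum_div, ← Finset.sum_neg_distrib]
  exact Finset.sum_congr rfl fun i _ => by ring

variable {G : Type*} [Group G] [Fintype G]

theorem sum_autocorrelation {lam : G → ℝ} (hlam : ∑ g, lam g = 1) :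
    ∑ r, ∑ f, lam f * lam (f * r) = 1 := by
  rw [Finset.sum_comm]
  have : ∀ f, ∑ r, lam f * lam (f * r) = lam f := by
    intro f
    have h : ∑ r, lam (f * r) = ∑ r, lam r := Equiv.sum_comp (Equiv.mulLeft f) lam
    rw [← Finset.mul_sum, h, hlam, mul_one]
  simp only [this, hlam]

/-- The autocorrelation of a positive, nonconstant distribution on a group has strictly larger
entropy. -/
theorem sum_negMulLog_lt_autocorrelation {lam : G → ℝ} (hpos : ∀ g, 0 < lam g)
    (hlam : ∑ g, lam g = 1) (hne : ∃ g h, lam g ≠ lam h) :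
    ∑ g, Real.negMulLog (lam g) < ∑ r, Real.negMulLog (∑ f, lam f * lam (f * r)) := by
  -- Jensen with weights `lam f` at the points `lam (f * r)`; the indices `g * r⁻¹` and `h * r⁻¹`
  -- yield the two distinct values that make it strict.
  have key : ∀ r, ∑ f, lam f * Real.negMulLog (lam (f * r)) <
      Real.negMulLog (∑ f, lam f * lam (f * r)) := by
    intro r
    obtain ⟨g, h, hgh⟩ := hne
    refine Real.strictConcaveOn_negMulLog.lt_map_sum (t := Finset.univ) (w := lam)
      (p := fun f => lam (f * r)) (fun i _ => hpos i) hlam (fun i _ => (hpos _).le)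
      ⟨g * r⁻¹, Finset.mem_univ _, h * r⁻¹, Finset.mem_univ _, by simpa using hgh⟩
  calc ∑ g, Real.negMulLog (lam g)
      = ∑ f, lam f * ∑ r, Real.negMulLog (lam (f * r)) := by
        have : ∀ f, ∑ r, Real.negMulLog (lam (f * r)) = ∑ g, Real.negMulLog (lam g) := fun f =>
          Equiv.sum_comp (Equiv.mulLeft f) fun g => Real.negMulLog (lam g)
        simp only [this, ← Finset.sum_mul, hlam, one_mul]
    _ = ∑ r, ∑ f, lam f * Real.negMulLog (lam (f * r)) := by
        simp only [Finset.mul_sum]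
        exact Finset.sum_comm
    _ < _ := Finset.sum_lt_sum_of_nonempty ⟨1, Finset.mem_univ _⟩ fun r _ => key r

end Entropy

/-! ### The tail bound for coefficient matrices. -/

section MatrixBound

open scoped Kronecker

/-- The square of the Frobenius norm. -/
noncomputable def frobeniusSq {α β : Type*} [Fintype α] [Fintype β] (X : Matrix α β ℂ) : ℝ :=
  ∑ i, ∑ j, ‖X i j‖ ^ 2

variable {α β γ δ : Type*} [Fintype α] [Fintype β] [Fintype γ] [Fintype δ]

theorem frobeniusSq_smul (c : ℂ) (X : Matrix α β ℂ) :
    frobeniusSq (c • X) = ‖c‖ ^ 2 * frobeniusSq X := by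
  simp [frobeniusSq, mul_pow, Finset.mul_sum]

theorem frobeniusSq_kronecker (X : Matrix α β ℂ) (Y : Matrix γ δ ℂ) :
    frobeniusSq (X ⊗ₖ Y) = frobeniusSq X * frobeniusSq Y := by
  simp only [frobeniusSq, Matrix.kroneckerMap_apply, norm_mul, mul_pow, Fintype.sum_prod_type,
    Finset.sum_mul_sum]

theorem exists_orthonormal_mulVec_eq_zero (N : Matrix α β ℂ) :
    ∃ (p : ℕ) (v : Fin p → EuclideanSpace ℂ β), Orthonormal ℂ v ∧
      Fintype.card β ≤ p + Fintype.card α ∧ ∀ j, N.mulVec (v j).ofLp = 0 := by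
  classical
  let L : EuclideanSpace ℂ β →ₗ[ℂ] (α → ℂ) :=
    N.mulVecLin ∘ₗ (WithLp.linearEquiv 2 ℂ (β → ℂ)).toLinearMap
  have hrank := L.finrank_range_add_finrank_ker
  have hle : finrank ℂ L.range ≤ Fintype.card α := by
    simpa using Submodule.finrank_le L.range
  rw [finrank_euclideanSpace] at hrank
  refine ⟨finrank ℂ L.ker, fun j => (stdOrthonormalBasis ℂ L.ker j : EuclideanSpace ℂ β),
    (stdOrthonormalBasis ℂ L.ker).orthonormal.comp_linearIsometry L.ker.subtypeₗᵢ, by omega,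
    fun j => ?_⟩
  exact LinearMap.mem_ker.1 (stdOrthonormalBasis ℂ L.ker j).2

/-- Bessel's inequality for each conjugated row of `X`. -/
theorem sum_norm_sq_mulVec_le {κ : Type*} [Fintype κ] {v : κ → EuclideanSpace ℂ β}
    (hv : Orthonormal ℂ v) (X : Matrix α β ℂ) :
    ∑ j, ∑ i, ‖X.mulVec (v j).ofLp i‖ ^ 2 ≤ frobeniusSq X := by
  rw [Finset.sum_comm, frobeniusSq]
  refine Finset.sum_le_sum fun i _ => ?_
  have h := hv.sum_inner_products_le (s := Finset.univ)
    (WithLp.toLp 2 (fun b => star (X i b)) : EuclideanSpace ℂ β)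
  rw [EuclideanSpace.norm_sq_eq] at h
  simp only [norm_star] at h
  refine le_of_eq_of_le (Finset.sum_congr rfl fun j _ => ?_) h
  rw [← norm_inner_symm]
  congr 2
  simp [Matrix.mulVec, dotProduct, PiLp.inner_apply, mul_comm]

theorem sum_norm_sq_apply_le_one [DecidableEq β] {κ : Type*} [Fintype κ]
    {v : κ → EuclideanSpace ℂ β} (hv : Orthonormal ℂ v) (b : β) : ∑ j, ‖v j b‖ ^ 2 ≤ 1 := by
  have h := hv.sum_inner_products_le (s := Finset.univ) (EuclideanSpace.single b (1 : ℂ))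
  simpa [EuclideanSpace.inner_single_right] using h

theorem sum_sum_norm_sq_apply {κ : Type*} [Fintype κ]
    {v : κ → EuclideanSpace ℂ β} (hv : Orthonormal ℂ v) :
    ∑ b, ∑ j, ‖v j b‖ ^ 2 = Fintype.card κ := by
  rw [Finset.sum_comm]
  simp [← EuclideanSpace.norm_sq_eq, hv.norm_eq_one]

variable {G : Type*} [Group G] [Fintype G] [DecidableEq G]

/-- The coefficient matrix of a group-shifted state with coefficients `s`. -/
def shiftMatrix (s : G → ℂ) (f : G) : Matrix G G ℂ :=
  Matrix.of fun g h => if h = f * g then s g else 0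

theorem frobeniusSq_shiftMatrix (s : G → ℂ) (f : G) :
    frobeniusSq (shiftMatrix s f) = ∑ g, ‖s g‖ ^ 2 := by
  simp only [frobeniusSq, shiftMatrix, Matrix.of_apply]
  refine Finset.sum_congr rfl fun g _ => ?_
  rw [Finset.sum_eq_single (f * g)] <;> simp +contextual

/-- The matrix is a diagonal matrix times a permutation matrix, so neither the shift nor the phases
affect the modulus. -/
theorem norm_det_shiftMatrix (s : G → ℂ) (f : G) :
    ‖(shiftMatrix s f).det‖ = ∏ g, ‖s g‖ := by
  have h : shiftMatrix s f =
      Matrix.diagonal s * (Equiv.Perm.permMatrix ℂ (Equiv.mulLeft f)) := by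
    ext g h
    rw [Matrix.diagonal_mul, Equiv.Perm.permMatrix, PEquiv.toMatrix_apply, shiftMatrix]
    simp [eq_comm]
  rw [h, Matrix.det_mul, Matrix.det_diagonal, Matrix.det_permutation, norm_mul, norm_prod]
  rcases Int.units_eq_one_or (Equiv.Perm.sign (Equiv.mulLeft f)) with h | h <;> simp [h]

theorem shiftMatrix_kronecker_mulVec (s : G → ℂ) (f : G) (w : G × G → ℂ) (g a : G) :
    (shiftMatrix s f ⊗ₖ shiftMatrix s f).mulVec w (g, a) =
      s g * s a * w (f * g, f * a) := by
  rw [Matrix.mulVec, dotProduct, Finset.sum_eq_single (f * g, f * a)]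
  · simp [shiftMatrix]
  · rintro ⟨x, y⟩ - hxy
    simp only [Matrix.kroneckerMap_apply, shiftMatrix, Matrix.of_apply]
    split_ifs with h1 h2
    · exact absurd (Prod.ext h1 h2) hxy
    all_goals simp
  · simp

/-- Summed over the group, the products of shifted states with themselves are diagonal, with the
autocorrelation of the distribution as diagonal entries. -/
theorem sum_norm_sq_shiftMatrix_kronecker_mulVec {s : G → G → ℂ} {lam : G → ℝ}
    (hs : ∀ f g, ‖s f g‖ ^ 2 = lam g) (w : G × G → ℂ) :
    ∑ f, ∑ i, ‖(shiftMatrix (s f) f ⊗ₖ shiftMatrix (s f) f).mulVec w i‖ ^ 2 =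
      ∑ r, (∑ h, ‖w (h, h * r)‖ ^ 2) * ∑ g, lam g * lam (g * r) := by
  simp only [Fintype.sum_prod_type, shiftMatrix_kronecker_mulVec, norm_mul, mul_pow, hs]
  -- With `a = g * r` and `h = f * g`, the entry of `w` depends on `h` and `r` only, and the sum
  -- over `g` becomes the autocorrelation.
  calc ∑ f, ∑ g, ∑ a, lam g * lam a * ‖w (f * g, f * a)‖ ^ 2
      = ∑ f, ∑ g, ∑ r, lam g * lam (g * r) * ‖w (f * g, f * g * r)‖ ^ 2 := by
        refine Finset.sum_congr rfl fun f _ => Finset.sum_congr rfl fun g _ => ?_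
        rw [← Equiv.sum_comp (Equiv.mulLeft g)]
        simp [mul_assoc]
    _ = ∑ g, ∑ h, ∑ r, lam g * lam (g * r) * ‖w (h, h * r)‖ ^ 2 := by
        rw [Finset.sum_comm]
        refine Finset.sum_congr rfl fun g _ => ?_
        exact Equiv.sum_comp (Equiv.mulRight g)
          fun h => ∑ r, lam g * lam (g * r) * ‖w (h, h * r)‖ ^ 2
    _ = ∑ r, ∑ h, ∑ g, lam g * lam (g * r) * ‖w (h, h * r)‖ ^ 2 := by
        rw [Finset.sum_comm]
        simp only [fun h => Finset.sum_comm (s := Finset.univ) (t := Finset.univ)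
          (f := fun g r => lam g * lam (g * r) * ‖w (h, h * r)‖ ^ 2)]
        exact Finset.sum_comm
    _ = _ := by
        refine Finset.sum_congr rfl fun r _ => ?_
        simp only [← Finset.sum_mul, ← Finset.mul_sum]
        ring

/-- If the shifted states are mapped to their squares by the same product operator, then the
factors of proportionality have the same modulus. -/
theorem norm_factor_eq {s : G → G → ℂ} {lam : G → ℝ} (hs : ∀ f g, ‖s f g‖ ^ 2 = lam g)
    (hpos : ∀ g, 0 < lam g) {A B : Matrix (G × G) (G × G) ℂ} {Φ : Matrix G G ℂ} {c : G → ℂ}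
    (hc : ∀ f, A * (shiftMatrix (s f) f ⊗ₖ Φ) * B =
      c f • (shiftMatrix (s f) f ⊗ₖ shiftMatrix (s f) f)) (f f' : G) :
    ‖c f‖ = ‖c f'‖ := by
  have hnorm : ∀ f g, ‖s f g‖ = √(lam g) := fun f g => by
    rw [← hs f g, Real.sqrt_sq (norm_nonneg _)]
  set d := ∏ g, √(lam g)
  have hd : 0 < d := Finset.prod_pos fun g _ => Real.sqrt_pos.2 (hpos g)
  have hdet : ∀ f, ‖(shiftMatrix (s f) f).det‖ = d := fun f => by
    rw [norm_det_shiftMatrix]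
    exact Finset.prod_congr rfl fun g _ => hnorm f g
  have key : ∀ f, ‖A.det‖ * (d ^ Fintype.card G * ‖Φ.det‖ ^ Fintype.card G) * ‖B.det‖ =
      ‖c f‖ ^ Fintype.card (G × G) * (d ^ Fintype.card G * d ^ Fintype.card G) := fun f => by
    have h := congrArg (fun X => ‖Matrix.det X‖) (hc f)
    simpa only [Matrix.det_mul, Matrix.det_smul, Matrix.det_kronecker, norm_mul, norm_pow, hdet]
      using h
  have h := (key f).symm.trans (key f')
  have h2 := mul_right_cancel₀ (by positivity) h
  exact (pow_left_inj₀ (norm_nonneg _) (norm_nonneg _) Fintype.card_ne_zero).1 h2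

/-- The majorization bound for local cloning: the best approximation of rank `k` to the blank
state leaves at least the `D - k` smallest values of the autocorrelation. -/
theorem autocorrelation_tail_le {μ : Type*} [Fintype μ] {s : G → G → ℂ} {lam : G → ℝ}
    (hs : ∀ f g, ‖s f g‖ ^ 2 = lam g) (hpos : ∀ g, 0 < lam g) (hlam : ∑ g, lam g = 1)
    {A B : μ → Matrix (G × G) (G × G) ℂ}
    (hAB : ∀ X, ∑ m, frobeniusSq (A m * X * B m) = frobeniusSq X)
    {Φ Φ₂ : Matrix G G ℂ} (hΦ : frobeniusSq Φ = 1) {c : μ → G → ℂ}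
    (hc : ∀ m f, A m * (shiftMatrix (s f) f ⊗ₖ Φ) * B m =
      c m f • (shiftMatrix (s f) f ⊗ₖ shiftMatrix (s f) f))
    {n k : ℕ} {U : Matrix G (Fin k) ℂ} {V : Matrix (Fin k) G ℂ} (hsplit : Φ = U * V + Φ₂)
    (e : Fin n ≃ G) (he : Antitone fun i => ∑ f, lam f * lam (f * e i)) (hk : k ≤ n) :
    ∑ i : Fin n with k ≤ i.val, ∑ f, lam f * lam (f * e i) ≤ frobeniusSq Φ₂ := by
  set q : G → ℝ := fun r => ∑ f, lam f * lam (f * r)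
  set Y : G → Matrix (G × G) (G × G) ℂ := fun f => shiftMatrix (s f) f ⊗ₖ shiftMatrix (s f) f
  have hn : n = Fintype.card G := by simpa using Fintype.card_congr e
  have hD : (0 : ℝ) < Fintype.card G := by exact_mod_cast Fintype.card_pos
  have hΨ : ∀ f, frobeniusSq (shiftMatrix (s f) f) = 1 := fun f => by
    rw [frobeniusSq_shiftMatrix, ← hlam]
    exact Finset.sum_congr rfl fun g _ => hs f g
  have hq0 : ∀ r, 0 ≤ q r := fun r =>
    Finset.sum_nonneg fun f _ => mul_nonneg (hpos _).le (hpos _).le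
  have hcsum : ∑ m, ‖c m 1‖ ^ 2 = 1 := by
    have h := hAB (shiftMatrix (s 1) 1 ⊗ₖ Φ)
    simpa only [hc, frobeniusSq_smul, frobeniusSq_kronecker, hΨ, hΦ, mul_one] using h
  have step : ∀ m, ‖c m 1‖ ^ 2 * (Fintype.card G * ∑ i : Fin n with k ≤ i.val, q (e i)) ≤
      ∑ f, frobeniusSq (A m * (shiftMatrix (s f) f ⊗ₖ Φ₂) * B m) := by
    intro m
    -- The low-rank part of `Ψ_f ⊗ Φ` factors through `1 ⊗ V`, which does not involve `f`: one
    -- kernel serves all `f`. As `1 ⊗ V` has `D * k` rows, `p ≥ D ^ 2 - D * k`.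
    obtain ⟨p, v, hv, hp, hker⟩ :=
      exists_orthonormal_mulVec_eq_zero (((1 : Matrix G G ℂ) ⊗ₖ V) * B m)
    -- The weight of the kernel on the `D` positions `(h, h * r)` that share the diagonal value `q
    -- r`; Bessel bounds each position by `1`.
    set t : G → ℝ := fun r => ∑ h, ∑ j, ‖v j (h, h * r)‖ ^ 2
    have ht0 : ∀ r, 0 ≤ t r := fun r =>
      Finset.sum_nonneg fun h _ => Finset.sum_nonneg fun j _ => by positivity
    have ht1 : ∀ r, t r ≤ Fintype.card G := fun r => by
      have := Finset.sum_le_sum fun h (_ : h ∈ (Finset.univ : Finset G)) =>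
        sum_norm_sq_apply_le_one hv (h, h * r)
      simpa using this
    have htsum : ∑ i, t (e i) = p := by
      rw [Equiv.sum_comp e t]
      have h := sum_sum_norm_sq_apply hv
      rw [Fintype.sum_prod_type, Fintype.card_fin] at h
      rw [← h, Finset.sum_comm]
      refine Finset.sum_congr rfl fun h _ => ?_
      exact Equiv.sum_comp (Equiv.mulLeft h) fun a => ∑ j, ‖v j (h, a)‖ ^ 2
    have hcount : (Fintype.card G : ℝ) * (n - k : ℝ) ≤ ∑ i, t (e i) := by
      rw [htsum, hn, mul_sub, sub_le_iff_le_add]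
      simp only [Fintype.card_prod, Fintype.card_fin] at hp
      exact_mod_cast hp
    have hbound := sum_tail_le_weighted_sum (p := fun i => q (e i)) he (fun i => hq0 _)
      (s := fun i => t (e i)) (fun i => ht0 _) (fun i => ht1 _) k hk hcount
    rw [Equiv.sum_comp e fun r => t r * q r] at hbound
    have hY : ∑ f, ∑ j, ∑ i, ‖(Y f).mulVec (v j).ofLp i‖ ^ 2 = ∑ r, t r * q r := by
      rw [Finset.sum_comm]
      simp only [Y, sum_norm_sq_shiftMatrix_kronecker_mulVec hs]
      rw [Finset.sum_comm]
      refine Finset.sum_congr rfl fun r _ => ?_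
      rw [← Finset.sum_mul, Finset.sum_comm]
    have hvec : ∀ f j, (A m * (shiftMatrix (s f) f ⊗ₖ Φ₂) * B m).mulVec (v j).ofLp =
        c m f • (Y f).mulVec (v j).ofLp := by
      intro f j
      rw [← Matrix.smul_mulVec, ← hc, hsplit, Matrix.kronecker_add, mul_add, add_mul,
        Matrix.add_mulVec, right_eq_add]
      have : shiftMatrix (s f) f ⊗ₖ (U * V) =
          (shiftMatrix (s f) f ⊗ₖ U) * ((1 : Matrix G G ℂ) ⊗ₖ V) := by
        rw [← Matrix.mul_kronecker_mul, mul_one]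
      rw [this, ← Matrix.mul_assoc (A m), Matrix.mul_assoc _ _ (B m), ← Matrix.mulVec_mulVec, hker,
        Matrix.mulVec_zero]
    calc ‖c m 1‖ ^ 2 * (Fintype.card G * ∑ i : Fin n with k ≤ i.val, q (e i))
        ≤ ‖c m 1‖ ^ 2 * ∑ r, t r * q r := mul_le_mul_of_nonneg_left hbound (by positivity)
      _ = ∑ f, ∑ j, ∑ i, ‖(A m * (shiftMatrix (s f) f ⊗ₖ Φ₂) * B m).mulVec (v j).ofLp i‖ ^ 2 := by
          rw [← hY, Finset.mul_sum]
          refine Finset.sum_congr rfl fun f _ => ?_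
          simp only [hvec, Pi.smul_apply, norm_smul, mul_pow, Finset.mul_sum,
            norm_factor_eq hs hpos (hc m) f 1]
      _ ≤ _ := Finset.sum_le_sum fun f _ => sum_norm_sq_mulVec_le hv _
  -- Summing over `m` uses `∑ |c_m|² = 1` on the left and norm preservation for each `f` on the
  -- right; a factor `D` then cancels.
  have hfinal := Finset.sum_le_sum fun m (_ : m ∈ Finset.univ) => step m
  rw [← Finset.sum_mul, hcsum, one_mul] at hfinal
  replace hfinal := hfinal.trans_eq Finset.sum_comm
  simp only [hAB, frobeniusSq_kronecker, hΨ, one_mul, Finset.sum_const, Finset.card_univ,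
    nsmul_eq_mul] at hfinal
  exact le_of_mul_le_mul_left hfinal hD

end MatrixBound

/-! ### Coefficient matrices of bipartite vectors and Kraus operators. -/

section Coefficients

open scoped Kronecker

variable {HA : Type*} [NormedAddCommGroup HA] [InnerProductSpace ℂ HA] [FiniteDimensional ℂ HA]
variable {HB : Type*} [NormedAddCommGroup HB] [InnerProductSpace ℂ HB] [FiniteDimensional ℂ HB]
variable {ι κ : Type*} [Fintype ι] [Fintype κ]

/-- The matrix of coefficients of a bipartite vector with respect to orthonormal bases. -/
noncomputable def coefMatrix (a : OrthonormalBasis ι ℂ HA) (b : OrthonormalBasis κ ℂ HB) :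
    HA ⊗[ℂ] HB →ₗ[ℂ] Matrix ι κ ℂ where
  toFun χ := Matrix.of fun i j => (a.tensorProduct b).repr χ (i, j)
  map_add' _ _ := by ext; simp
  map_smul' _ _ := by ext; simp

theorem coefMatrix_tmul (a : OrthonormalBasis ι ℂ HA) (b : OrthonormalBasis κ ℂ HB) (x : HA)
    (y : HB) : coefMatrix a b (x ⊗ₜ[ℂ] y) = Matrix.vecMulVec (a.repr x) (b.repr y) := by
  ext i j
  simp [coefMatrix, OrthonormalBasis.tensorProduct_repr_tmul_apply, Matrix.vecMulVec_apply,
    mul_comm]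

theorem frobeniusSq_coefMatrix (a : OrthonormalBasis ι ℂ HA) (b : OrthonormalBasis κ ℂ HB)
    (χ : HA ⊗[ℂ] HB) : frobeniusSq (coefMatrix a b χ) = ‖χ‖ ^ 2 := by
  rw [← (a.tensorProduct b).repr.norm_map χ, EuclideanSpace.norm_sq_eq, Fintype.sum_prod_type]
  rfl

theorem coefMatrix_surjective (a : OrthonormalBasis ι ℂ HA) (b : OrthonormalBasis κ ℂ HB) :
    Function.Surjective (coefMatrix a b) := by
  intro X
  refine ⟨(a.tensorProduct b).repr.symm (WithLp.toLp 2 fun p => X p.1 p.2), ?_⟩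
  ext i j
  simp [coefMatrix]

/-- Product operators become two-sided multiplication. The second factor carries a plain transpose
because coefficients are linear in both tensor factors. -/
theorem coefMatrix_map [DecidableEq ι] [DecidableEq κ] (a : OrthonormalBasis ι ℂ HA)
    (b : OrthonormalBasis κ ℂ HB) (S : HA →ₗ[ℂ] HA) (T : HB →ₗ[ℂ] HB) (χ : HA ⊗[ℂ] HB) :
    coefMatrix a b (TensorProduct.map S T χ) =
      LinearMap.toMatrix a.toBasis a.toBasis S * coefMatrix a b χ *
        (LinearMap.toMatrix b.toBasis b.toBasis T).transpose := by
  induction χ with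
  | zero => simp
  | tmul x y =>
    have hS := LinearMap.toMatrix_mulVec_repr a.toBasis a.toBasis S x
    have hT := LinearMap.toMatrix_mulVec_repr b.toBasis b.toBasis T y
    rw [TensorProduct.map_tmul, coefMatrix_tmul, coefMatrix_tmul, Matrix.mul_vecMulVec,
      Matrix.vecMulVec_mul, Matrix.vecMul_transpose]
    congr 1
    · exact hS.symm
    · exact hT.symm
  | add x y hx hy => simp only [map_add, hx, hy, Matrix.mul_add, Matrix.add_mul]

theorem coefMatrix_jointState (a : OrthonormalBasis ι ℂ HA) (b : OrthonormalBasis κ ℂ HB)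
    (χ η : HA ⊗[ℂ] HB) :
    coefMatrix (a.tensorProduct a) (b.tensorProduct b) (jointState χ η) =
      coefMatrix a b χ ⊗ₖ coefMatrix a b η := by
  unfold jointState
  induction χ with
  | zero => simp
  | tmul x y =>
    induction η with
    | zero => simp
    | tmul z w =>
      rw [TensorProduct.tensorTensorTensorComm_tmul, coefMatrix_tmul, coefMatrix_tmul,
        coefMatrix_tmul]
      ext ⟨i, j⟩ ⟨k, l⟩
      simp only [Matrix.vecMulVec_apply, Matrix.kroneckerMap_apply,
        OrthonormalBasis.tensorProduct_repr_tmul_apply]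
      ring
    | add z w hz hw => simp only [TensorProduct.tmul_add, map_add, Matrix.kronecker_add, hz, hw]
  | add x y hx hy => simp only [TensorProduct.add_tmul, map_add, Matrix.add_kronecker, hx, hy]

theorem norm_jointState (χ η : HA ⊗[ℂ] HB) : ‖jointState χ η‖ = ‖χ‖ * ‖η‖ := by
  let a := stdOrthonormalBasis ℂ HA
  let b := stdOrthonormalBasis ℂ HB
  refine (pow_left_inj₀ (norm_nonneg _) (by positivity) two_ne_zero).1 ?_
  rw [mul_pow, ← frobeniusSq_coefMatrix a b, ← frobeniusSq_coefMatrix a b,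
    ← frobeniusSq_kronecker, ← coefMatrix_jointState, frobeniusSq_coefMatrix]

theorem coefMatrix_groupShifted {G : Type*} [Group G] [Fintype G] [DecidableEq G]
    (eA : OrthonormalBasis G ℂ HA) (eB : OrthonormalBasis G ℂ HB) (lam : G → ℝ) (θ : G → G → ℝ)
    (f : G) : coefMatrix eA eB (groupShifted eA eB lam θ f) =
      shiftMatrix (fun g => (√(lam g) : ℂ) * Complex.exp (Complex.I * (θ f g : ℂ))) f := by
  ext g h
  simp only [groupShifted, map_sum, map_smul, coefMatrix_tmul, Matrix.sum_apply, Matrix.smul_apply,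
    Matrix.vecMulVec_apply, OrthonormalBasis.repr_self, PiLp.single_apply, shiftMatrix,
    Matrix.of_apply]
  rw [Finset.sum_eq_single g]
  · simp
  · intro x _ hx
    simp [hx.symm]
  · simp

/-- If the Kraus operators map a pure state to a pure state, then each of them maps the one vector
to a multiple of the other. -/
theorem exists_smul_eq_of_sum_ketbra {K : Type*} [NormedAddCommGroup K] [InnerProductSpace ℂ K]
    [FiniteDimensional ℂ K] {μ : Type*} [Fintype μ] (E : μ → K →ₗ[ℂ] K) {x y : K} (hy : ‖y‖ = 1)
    (h : ketbra y = ∑ m, E m ∘ₗ ketbra x ∘ₗ (E m).adjoint) (m : μ) :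
    ∃ c : ℂ, E m x = c • y := by
  refine ⟨inner ℂ y (E m x), ?_⟩
  set z := E m x - inner ℂ y (E m x) • y with hz
  have hyz : inner ℂ y z = 0 := by
    rw [hz, inner_sub_right, inner_smul_right, inner_self_eq_norm_sq_to_K, hy]
    simp
  -- Testing against `z`, the part of `E m x` orthogonal to `y`, kills the left side; on the right
  -- stands a sum of nonnegative terms, so each vanishes.
  have h1 := congrArg (fun T : K →ₗ[ℂ] K => inner ℂ z (T z)) h
  have h2 : ∑ m, ‖inner ℂ (E m x) z‖ ^ 2 = 0 := by
    simp only [ketbra, LinearMap.sum_apply, LinearMap.comp_apply, ContinuousLinearMap.coe_coe,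
      InnerProductSpace.rankOne_apply, hyz, zero_smul, inner_zero_right, inner_sum,
      LinearMap.adjoint_inner_right, map_smul, inner_smul_right] at h1
    have h3 : ∀ m, inner ℂ (E m x) z * inner ℂ z (E m x) = ((‖inner ℂ (E m x) z‖ ^ 2 : ℝ) : ℂ) := by
      intro m
      rw [← inner_conj_symm z, RCLike.mul_conj]
      norm_cast
    simp only [h3] at h1
    exact_mod_cast h1.symm
  have h3 : inner ℂ (E m x) z = 0 := by
    have := (Finset.sum_eq_zero_iff_of_nonneg fun i _ => by positivity).1 h2 m (Finset.mem_univ _)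
    simpa using this
  have h4 : inner ℂ z z = 0 := by
    conv_lhs => rw [hz]
    rw [inner_sub_left, inner_smul_left, h3, hyz]
    simp
  exact sub_eq_zero.1 (inner_self_eq_zero.1 h4)

theorem sum_norm_sq_map_of_closure {μ : Type*} [Fintype μ] {A : μ → HA →ₗ[ℂ] HA}
    {B : μ → HB →ₗ[ℂ] HB}
    (h : ∑ m, TensorProduct.map ((A m).adjoint ∘ₗ A m) ((B m).adjoint ∘ₗ B m) = LinearMap.id)
    (χ : HA ⊗[ℂ] HB) : ∑ m, ‖TensorProduct.map (A m) (B m) χ‖ ^ 2 = ‖χ‖ ^ 2 := by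
  have h1 := congrArg (fun T : HA ⊗[ℂ] HB →ₗ[ℂ] HA ⊗[ℂ] HB => (inner ℂ χ (T χ)).re) h
  simp only [TensorProduct.map_comp, ← TensorProduct.adjoint_map, LinearMap.sum_apply,
    LinearMap.comp_apply, LinearMap.id_apply, inner_sum, LinearMap.adjoint_inner_right,
    Complex.re_sum] at h1
  simpa only [norm_sq_eq_re_inner (𝕜 := ℂ), RCLike.re_to_complex] using h1

end Coefficients

/-! ### From clonability to majorization, and the final theorem. -/

section Cloning

open scoped Kronecker

variable {G : Type*} [Group G] [Fintype G]
variable {HA : Type*} [NormedAddCommGroup HA] [InnerProductSpace ℂ HA] [FiniteDimensional ℂ HA]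
variable {HB : Type*} [NormedAddCommGroup HB] [InnerProductSpace ℂ HB] [FiniteDimensional ℂ HB]

theorem norm_sq_groupShifted_coeff {lam : G → ℝ} (hlam : ∀ g, 0 ≤ lam g) (θ : G → G → ℝ)
    (f g : G) : ‖(√(lam g) : ℂ) * Complex.exp (Complex.I * (θ f g : ℂ))‖ ^ 2 = lam g := by
  rw [norm_mul, mul_comm Complex.I, Complex.norm_exp_ofReal_mul_I, mul_one, Complex.norm_real,
    Real.norm_eq_abs, sq_abs, Real.sq_sqrt (hlam g)]

theorem map_schmidtCoeff_groupShifted (eA : OrthonormalBasis G ℂ HA)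
    (eB : OrthonormalBasis G ℂ HB) {lam : G → ℝ} (hlam : ∀ g, 0 ≤ lam g) (θ : G → G → ℝ) (f : G) :
    (Finset.univ : Finset (Fin (finrank ℂ HA))).val.map
        (schmidtCoeff (groupShifted eA eB lam θ f)) =
      (Finset.univ : Finset G).val.map lam := by
  -- Renumbering `eB` by left multiplication with `f` turns the defining sum into a Schmidt
  -- decomposition.
  rw [map_schmidtCoeff_eq eA (eB.reindex (Equiv.mulLeft f).symm)
    (fun g => (√(lam g) : ℂ) * Complex.exp (Complex.I * (θ f g : ℂ)))]
  · simp only [norm_sq_groupShifted_coeff hlam]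
  · simp [groupShifted]

theorem norm_groupShifted (eA : OrthonormalBasis G ℂ HA) (eB : OrthonormalBasis G ℂ HB)
    {lam : G → ℝ} (hlam : ∀ g, 0 ≤ lam g) (hsum : ∑ g, lam g = 1) (θ : G → G → ℝ) (f : G) :
    ‖groupShifted eA eB lam θ f‖ = 1 := by
  classical
  refine (pow_left_inj₀ (norm_nonneg _) zero_le_one two_ne_zero).1 ?_
  rw [← frobeniusSq_coefMatrix eA eB, coefMatrix_groupShifted, frobeniusSq_shiftMatrix]
  simp only [norm_sq_groupShifted_coeff hlam, hsum, one_pow]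

theorem schmidtCoeff_antitone (χ : HA ⊗[ℂ] HB) : Antitone (schmidtCoeff χ) := fun _ _ h =>
  pow_le_pow_left₀ (LinearMap.singularValues_nonneg _ _)
    (LinearMap.singularValues_antitone _ (Fin.le_def.1 h)) 2

/-- The Schmidt coefficients of the blank state are majorized by the autocorrelation. -/
theorem autocorrelation_tail_le_schmidtCoeff_tail (eA : OrthonormalBasis G ℂ HA)
    (eB : OrthonormalBasis G ℂ HB) {lam : G → ℝ} (hpos : ∀ g, 0 < lam g)
    (hsum : ∑ g, lam g = 1) (θ : G → G → ℝ) {φ : HA ⊗[ℂ] HB} (hφ : ‖φ‖ = 1)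
    (hclone : LocallyClonable (Set.range (groupShifted eA eB lam θ)) φ)
    (e : Fin (finrank ℂ HA) ≃ G) (he : Antitone fun i => ∑ f, lam f * lam (f * e i))
    {k : ℕ} (hk : k ≤ finrank ℂ HA) :
    ∑ i : Fin (finrank ℂ HA) with k ≤ i.val, ∑ f, lam f * lam (f * e i) ≤
      ∑ i : Fin (finrank ℂ HA) with k ≤ i.val, schmidtCoeff φ i := by
  classical
  have hdim : finrank ℂ HB = finrank ℂ HA := by
    rw [finrank_eq_card_basis eA.toBasis, finrank_eq_card_basis eB.toBasis]
  obtain ⟨x, y, hy, hxy, hx⟩ := exists_schmidt_decomposition hdim φ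
  obtain ⟨Λ, ⟨M, A, B, hcl, hΛ⟩, hmap⟩ := hclone
  set aA := eA.tensorProduct eA
  set bB := eB.tensorProduct eB
  have hK : ∀ m f, ∃ c : ℂ, TensorProduct.map (A m) (B m)
      (jointState (groupShifted eA eB lam θ f) φ) =
        c • jointState (groupShifted eA eB lam θ f) (groupShifted eA eB lam θ f) := by
    intro m f
    refine exists_smul_eq_of_sum_ketbra (fun m => TensorProduct.map (A m) (B m)) ?_ ?_ m
    · rw [norm_jointState, norm_groupShifted eA eB (fun g => (hpos g).le) hsum, one_mul]
    · rw [← hmap _ ⟨f, rfl⟩, hΛ]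
  choose c hc using hK
  -- The first `k` Schmidt terms form a product of a `D × k` and a `k × D` matrix.
  have hsplit : coefMatrix eA eB φ =
      (Matrix.of fun g (i : Fin k) => eA.repr (x (Fin.castLE hk i)) g) *
        (Matrix.of fun (i : Fin k) g => eB.repr (y (Fin.castLE hk i)) g) +
      coefMatrix eA eB (∑ i : Fin (finrank ℂ HA) with k ≤ i.val, x i ⊗ₜ[ℂ] y i) := by
    conv_lhs => rw [hxy, ← Finset.sum_filter_add_sum_filter_not _ fun i => k ≤ i.val, add_comm]
    rw [map_add, add_left_inj]
    have himage : (Finset.univ.filter fun i : Fin (finrank ℂ HA) => ¬ k ≤ i.val) =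
        Finset.univ.map (Fin.castLEEmb hk) := by
      ext i
      simp only [Finset.mem_filter, Finset.mem_univ, true_and, Finset.mem_map, not_le]
      exact ⟨fun h => ⟨⟨i, h⟩, rfl⟩, by rintro ⟨j, rfl⟩; exact j.2⟩
    rw [himage, Finset.sum_map, map_sum]
    ext g h
    simp [coefMatrix_tmul, Matrix.sum_apply, Matrix.mul_apply, Matrix.vecMulVec_apply]
  have h := autocorrelation_tail_le
    (s := fun f g => (√(lam g) : ℂ) * Complex.exp (Complex.I * (θ f g : ℂ)))
    (norm_sq_groupShifted_coeff (fun g => (hpos g).le) θ) hpos hsum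
    (A := fun m => LinearMap.toMatrix aA.toBasis aA.toBasis (A m))
    (B := fun m => (LinearMap.toMatrix bB.toBasis bB.toBasis (B m)).transpose)
    (fun X => by
      obtain ⟨χ, rfl⟩ := coefMatrix_surjective aA bB X
      simp only [← coefMatrix_map, frobeniusSq_coefMatrix]
      exact sum_norm_sq_map_of_closure hcl χ)
    (Φ := coefMatrix eA eB φ) (by rw [frobeniusSq_coefMatrix, hφ, one_pow]) (c := c)
    (fun m f => by
      rw [← coefMatrix_groupShifted eA eB, ← coefMatrix_jointState, ← coefMatrix_jointState,
        ← coefMatrix_map, hc, map_smul])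
    hsplit e he hk
  rw [frobeniusSq_coefMatrix, norm_sq_sum_tmul_of_orthonormal x hy] at h
  simpa only [hx] using h

end Cloning

theorem mainTheorem9
    {G : Type*} [Group G] [Fintype G]
    {HA : Type*} [NormedAddCommGroup HA] [InnerProductSpace ℂ HA] [FiniteDimensional ℂ HA]
    {HB : Type*} [NormedAddCommGroup HB] [InnerProductSpace ℂ HB] [FiniteDimensional ℂ HB]
    (eA : OrthonormalBasis G ℂ HA) (eB : OrthonormalBasis G ℂ HB)
    (lam : G → ℝ) (hlam_nonneg : ∀ g, 0 ≤ lam g) (hlam_sum : ∑ g, lam g = 1)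
    (θ : G → G → ℝ)
    (hfull : ∀ f, FullSchmidtRank (groupShifted eA eB lam θ f))
    (hnotmax : ∀ f, ¬ MaximallyEntangled (groupShifted eA eB lam θ f))
    (φ : HA ⊗[ℂ] HB) (hφ : ‖φ‖ = 1)
    (hclone : LocallyClonable (Set.range (groupShifted eA eB lam θ)) φ)
    (q : G → ℝ) (hq : ∀ r, q r = ∑ f, lam f * lam (f * r)) :
    ∑ r, q r = 1 ∧
    entanglementEntropy φ ≥ shannonEntropy (Fintype.card G) q ∧
    ∀ f, shannonEntropy (Fintype.card G) q > entanglementEntropy (groupShifted eA eB lam θ f) := by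
  have hDA : finrank ℂ HA = Fintype.card G := finrank_eq_card_basis eA.toBasis
  have hDB : finrank ℂ HB = finrank ℂ HA := by rw [hDA, finrank_eq_card_basis eB.toBasis]
  have hcoeff := map_schmidtCoeff_groupShifted eA eB hlam_nonneg θ
  obtain rfl : q = fun r => ∑ f, lam f * lam (f * r) := funext hq
  have hq1 := sum_autocorrelation hlam_sum
  have hpos : ∀ g, 0 < lam g := by
    intro g
    refine (hlam_nonneg g).lt_of_ne' fun h0 => ?_
    have hmem : lam g ∈ (Finset.univ : Finset G).val.map lam :=
      Multiset.mem_map_of_mem _ (Finset.mem_univ g)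
    rw [← hcoeff 1, Multiset.mem_map] at hmem
    obtain ⟨r, -, hr⟩ := hmem
    have hrank := hfull 1
    rw [FullSchmidtRank, schmidtRank, Nat.card_eq_fintype_card] at hrank
    have hlt := Fintype.card_subtype_lt (p := fun r => schmidtCoeff (groupShifted eA eB lam θ 1) r ≠ 0)
      (x := r) (by simp [hr, h0])
    rw [Fintype.card_fin] at hlt
    exact hlt.ne hrank
  have hne : ∃ g h, lam g ≠ lam h := by
    by_contra! hconst
    refine hnotmax 1 fun r => ?_
    have hmem : schmidtCoeff (groupShifted eA eB lam θ 1) r ∈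
        (Finset.univ : Finset G).val.map lam := by
      rw [← hcoeff 1]
      exact Multiset.mem_map_of_mem _ (Finset.mem_univ r)
    obtain ⟨g, -, hg⟩ := Multiset.mem_map.1 hmem
    have hsum : (Fintype.card G : ℝ) * lam g = 1 := by
      rw [← hlam_sum, Finset.sum_congr rfl fun h _ => hconst h g]
      simp
    rw [← hg, hDA, eq_div_iff (by positivity), mul_comm, hsum]
  have hlog : 0 < Real.log (Fintype.card G) := by
    obtain ⟨g, h, hgh⟩ := hne
    refine Real.log_pos ?_
    exact_mod_cast Fintype.one_lt_card_iff.2 ⟨g, h, fun H => hgh (congrArg lam H)⟩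
  refine ⟨hq1, ?_, fun f => ?_⟩
  · obtain ⟨e, he⟩ : ∃ e : Fin (finrank ℂ HA) ≃ G,
        Antitone fun i => ∑ f, lam f * lam (f * e i) := by
      let e₀ : Fin (finrank ℂ HA) ≃ G := (Fintype.equivFinOfCardEq hDA.symm).symm
      -- Sorting is increasing, hence the sign.
      let w : Fin (finrank ℂ HA) → ℝ := fun i => -∑ f, lam f * lam (f * e₀ i)
      exact ⟨(Tuple.sort w).trans e₀, fun i j hij => neg_le_neg_iff.1 (Tuple.monotone_sort w hij)⟩
    obtain ⟨x, y, hy, hxy, hx⟩ := exists_schmidt_decomposition hDB φ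
    have hφ1 : ∑ i, schmidtCoeff φ i = 1 := by
      have h := norm_sq_sum_tmul_of_orthonormal x hy Finset.univ
      rw [← hxy, hφ, one_pow] at h
      simpa only [hx] using h.symm
    have h := sum_negMulLog_le_of_tail_le (schmidtCoeff_antitone φ)
      (p := fun i => ∑ f, lam f * lam (f * e i))
      (fun i => Finset.sum_pos (fun f _ => mul_pos (hpos _) (hpos _)) ⟨1, Finset.mem_univ _⟩)
      (by rw [hφ1, ← hq1]; exact Equiv.sum_comp e fun r => ∑ f, lam f * lam (f * r))
      (fun k hk => autocorrelation_tail_le_schmidtCoeff_tail eA eB hpos hlam_sum θ hφ hclone e he hk)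
    rw [ge_iff_le, entanglementEntropy, shannonEntropy_eq_sum_negMulLog,
      shannonEntropy_eq_sum_negMulLog, ← hDA]
    rw [← hDA] at hlog
    refine div_le_div_of_nonneg_right ?_ hlog.le
    rw [← Equiv.sum_comp e]
    exact h
  · have hE : ∑ r, Real.negMulLog (schmidtCoeff (groupShifted eA eB lam θ f) r) =
        ∑ g, Real.negMulLog (lam g) := by
      have h := congrArg (fun S => (Multiset.map Real.negMulLog S).sum) (hcoeff f)
      simp only [Multiset.map_map] at h
      exact h
    rw [gt_iff_lt, entanglementEntropy, shannonEntropy_eq_sum_negMulLog,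
      shannonEntropy_eq_sum_negMulLog, hE, hDA]
    exact div_lt_div_of_pos_right (sum_negMulLog_lt_autocorrelation hpos hlam_sum hne) hlog
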